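/- Let $k$ be a field and let $H$ be a Hopf algebra over $k$ that admits a nonzero left integral, i.e. a nonzero linear form $\Lambda : H \to k$ with $h_1\Lambda(h_2) = \Lambda(h)\,1$ for all $h \in H$ (such an $H$ is called co-Frobenius); fix such a $\Lambda$. For a right $H$-comodule $M$ with coaction $\rho(m) = m_0 \otimes m_1$, put $M^{coH} = \{m \in M : \rho(m) = m \otimes 1\}$, $\Lambda\cdot m = \Lambda(m_1)m_0$, $\Lambda \cdot M=\{\Lambda\cdot m : m\in M\} \subseteq M^{coH}$, and $\mathcal H_0^H(M) = M^{coH}/(\Lambda\cdot M)$. Let $\underline{\mathrm{Hom}}^H(M,N)$ be the space of $H$-colinear maps $M \to N$ modulo the subspace of those that factor through an injective object of the category $\mathcal M^H$ of right $H$-comodules; the stable category $\underline{\mathcal M}^H$ has the right $H$-comodules as objects and these quotients as Hom spaces. Then for every right $H$-comodule $M$ the map $f \mapsto f(1)$ from colinear maps $k \to M$ (where $k$ is the trivial comodule) to $M^{coH}$ induces a well-defined $k$-linear isomorphism $$\underline{\mathrm{Hom}}^H(k,M) \longrightarrow \mathcal H_0^H(M),\qquad [f] \mapsto [f(1)].$$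 Moreover $\mathcal H_0^H$ vanishes on morphisms that factor through an injective comodule, hence induces a functor $\underline{\mathcal M}^H \to {}_k\mathrm{Vect}$, and the isomorphisms above form a natural isomorphism of functors $\underline{\mathrm{Hom}}^H(k,-) \cong \mathcal H_0^H$ on $\underline{\mathcal M}^H$; that is, $\mathcal H_0^H$ is represented by the trivial comodule $k$ in the stable category. -/

import Mathlib

open CategoryTheory TensorProduct

universe u

/-- A left integral on a Hopf algebra `H`: a linear form `Λ` on `H` with `h₁ Λ(h₂) = Λ(h) 1`
for all `h`. -/
def IsLeftIntegral {k H : Type u} [Field k] [Ring H] [HopfAlgebra k H] (Λ : H →ₗ[k] k) : Prop :=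
  ∀ h : H, TensorProduct.rid k H (Λ.lTensor H (Coalgebra.comul (R := k) h)) = Λ h • (1 : H)

/-- Right `H`-comodules: a vector space `M` with a coassociative and counital coaction
`M → M ⊗ H`. -/
structure ComodCat (k H : Type u) [Field k] [Ring H] [HopfAlgebra k H] where
  carrier : Type u
  [addCommGroup : AddCommGroup carrier]
  [module : Module k carrier]
  coact : carrier →ₗ[k] carrier ⊗[k] H
  coassoc : (TensorProduct.assoc k carrier H H).toLinearMap ∘ₗ coact.rTensor H ∘ₗ coact =
    (Coalgebra.comul (R := k) (A := H)).lTensor carrier ∘ₗ coact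
  counit_coact : (Coalgebra.counit (R := k) (A := H)).lTensor carrier ∘ₗ coact =
    (TensorProduct.mk k carrier k).flip 1

namespace ComodCat

variable {k H : Type u} [Field k] [Ring H] [HopfAlgebra k H]

instance : CoeSort (ComodCat k H) (Type u) := ⟨carrier⟩

instance (M : ComodCat k H) : AddCommGroup M := M.addCommGroup

instance (M : ComodCat k H) : Module k M := M.module

/-- Colinear maps. -/
@[ext]
structure Hom (M N : ComodCat k H) where
  lin : M →ₗ[k] N
  colinear : N.coact ∘ₗ lin = lin.rTensor H ∘ₗ M.coact

instance : Category (ComodCat k H) where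
  Hom M N := Hom M N
  id M := ⟨LinearMap.id, by simp⟩
  comp f g := ⟨g.lin ∘ₗ f.lin, by
    rw [← LinearMap.comp_assoc, g.colinear, LinearMap.comp_assoc, f.colinear,
      LinearMap.rTensor_comp, LinearMap.comp_assoc]⟩

/-- The linear map underlying a morphism of comodules. -/
def lin {M N : ComodCat k H} (f : M ⟶ N) : M →ₗ[k] N := Hom.lin f

theorem colinear {M N : ComodCat k H} (f : M ⟶ N) :
    N.coact ∘ₗ lin f = (lin f).rTensor H ∘ₗ M.coact := Hom.colinear f

theorem coact_lin {M N : ComodCat k H} (f : M ⟶ N) (m : M) :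
    N.coact (lin f m) = (lin f).rTensor H (M.coact m) :=
  LinearMap.congr_fun (colinear f) m

theorem lin_injective (M N : ComodCat k H) :
    Function.Injective (lin : (M ⟶ N) → (M →ₗ[k] N)) :=
  fun _ _ h => Hom.ext h

/-- The morphism of comodules given by a colinear map. -/
def ofLin {M N : ComodCat k H} (f : M →ₗ[k] N) (hf : N.coact ∘ₗ f = f.rTensor H ∘ₗ M.coact) :
    M ⟶ N := Hom.mk f hf

@[simp] theorem lin_ofLin {M N : ComodCat k H} (f : M →ₗ[k] N)
    (hf : N.coact ∘ₗ f = f.rTensor H ∘ₗ M.coact) : lin (ofLin f hf) = f := rfl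

@[simp] theorem lin_id (M : ComodCat k H) : lin (𝟙 M) = LinearMap.id := rfl

@[simp] theorem lin_comp {M N P : ComodCat k H} (f : M ⟶ N) (g : N ⟶ P) :
    lin (f ≫ g) = lin g ∘ₗ lin f := rfl

section HomModule

variable (M N : ComodCat k H)

instance : Zero (M ⟶ N) := ⟨ofLin 0 (by simp)⟩

instance : Add (M ⟶ N) := ⟨fun f g => ofLin (lin f + lin g) (by
  rw [LinearMap.comp_add, colinear, colinear, LinearMap.rTensor_add, LinearMap.add_comp])⟩

instance : Neg (M ⟶ N) := ⟨fun f => ofLin (-lin f) (by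
  rw [LinearMap.comp_neg, colinear, LinearMap.rTensor_neg, LinearMap.neg_comp])⟩

instance : Sub (M ⟶ N) := ⟨fun f g => ofLin (lin f - lin g) (by
  rw [LinearMap.comp_sub, colinear, colinear, LinearMap.rTensor_sub, LinearMap.sub_comp])⟩

instance : SMul k (M ⟶ N) := ⟨fun c f => ofLin (c • lin f) (by
  rw [LinearMap.comp_smul, colinear, LinearMap.rTensor_smul, LinearMap.smul_comp])⟩

instance : SMul ℕ (M ⟶ N) := ⟨fun c f => ofLin (c • lin f) (by
  rw [← Nat.cast_smul_eq_nsmul k, LinearMap.comp_smul, colinear, LinearMap.rTensor_smul,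
    LinearMap.smul_comp])⟩

instance : SMul ℤ (M ⟶ N) := ⟨fun c f => ofLin (c • lin f) (by
  rw [← Int.cast_smul_eq_zsmul k, LinearMap.comp_smul, colinear, LinearMap.rTensor_smul,
    LinearMap.smul_comp])⟩

/-- Morphisms of comodules are added and scaled as linear maps. -/
instance : AddCommGroup (M ⟶ N) :=
  (lin_injective M N).addCommGroup lin rfl (fun _ _ => rfl) (fun _ => rfl) (fun _ _ => rfl)
    (fun _ _ => rfl) (fun _ _ => rfl)

/-- Taking underlying linear maps, as an additive map. -/
def linAddHom : (M ⟶ N) →+ (M →ₗ[k] N) where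
  toFun := lin
  map_zero' := rfl
  map_add' _ _ := rfl

instance : Module k (M ⟶ N) :=
  (lin_injective M N).module k (linAddHom M N) (fun _ _ => rfl)

end HomModule

@[simp] theorem lin_zero (M N : ComodCat k H) : lin (0 : M ⟶ N) = 0 := rfl

@[simp] theorem lin_add {M N : ComodCat k H} (f g : M ⟶ N) : lin (f + g) = lin f + lin g := rfl

@[simp] theorem lin_smul {M N : ComodCat k H} (c : k) (f : M ⟶ N) : lin (c • f) = c • lin f := rfl

instance : Preadditive (ComodCat k H) where
  add_comp _ _ _ _ _ _ := lin_injective _ _ (by simp [LinearMap.comp_add])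
  comp_add _ _ _ _ _ _ := lin_injective _ _ (by simp [LinearMap.add_comp])

instance : Linear k (ComodCat k H) where
  smul_comp _ _ _ _ _ _ := lin_injective _ _ (by simp [LinearMap.comp_smul])
  comp_smul _ _ _ _ _ _ := lin_injective _ _ (by simp [LinearMap.smul_comp])

variable (k H) in
/-- The trivial comodule `k`, with coaction `c ↦ c ⊗ 1`. -/
def trivial : ComodCat k H where
  carrier := k
  coact := (TensorProduct.mk k k H).flip 1
  coassoc := by
    ext
    simp [Algebra.TensorProduct.one_def]
  counit_coact := by
    ext
    simp

section Prod

variable (M N : ComodCat k H)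

/-- The coaction on the direct sum of two comodules. -/
def prodCoact : (M × N) →ₗ[k] (M × N) ⊗[k] H :=
  LinearMap.coprod ((LinearMap.inl k M N).rTensor H ∘ₗ M.coact)
    ((LinearMap.inr k M N).rTensor H ∘ₗ N.coact)

theorem prodCoact_comp_inl :
    prodCoact M N ∘ₗ LinearMap.inl k M N = (LinearMap.inl k M N).rTensor H ∘ₗ M.coact :=
  LinearMap.coprod_inl _ _

theorem prodCoact_comp_inr :
    prodCoact M N ∘ₗ LinearMap.inr k M N = (LinearMap.inr k M N).rTensor H ∘ₗ N.coact :=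
  LinearMap.coprod_inr _ _

theorem coassoc_of_comp {P : Type u} [AddCommGroup P] [Module k P] (ρ : P →ₗ[k] P ⊗[k] H)
    (i : M →ₗ[k] P) (h : ρ ∘ₗ i = i.rTensor H ∘ₗ M.coact) :
    ((TensorProduct.assoc k P H H).toLinearMap ∘ₗ ρ.rTensor H ∘ₗ ρ) ∘ₗ i =
      ((Coalgebra.comul (R := k) (A := H)).lTensor P ∘ₗ ρ) ∘ₗ i := by
  have h1 : (TensorProduct.assoc k P H H).toLinearMap ∘ₗ (i.rTensor H).rTensor H =
      i.rTensor (H ⊗[k] H) ∘ₗ (TensorProduct.assoc k M H H).toLinearMap := by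
    ext
    simp
  calc _ = (TensorProduct.assoc k P H H).toLinearMap ∘ₗ ρ.rTensor H ∘ₗ (ρ ∘ₗ i) := rfl
    _ = (TensorProduct.assoc k P H H).toLinearMap ∘ₗ (ρ ∘ₗ i).rTensor H ∘ₗ M.coact := by
      rw [h, ← h, LinearMap.rTensor_comp, h]
      rfl
    _ = ((TensorProduct.assoc k P H H).toLinearMap ∘ₗ (i.rTensor H).rTensor H) ∘ₗ
        M.coact.rTensor H ∘ₗ M.coact := by
      rw [h, LinearMap.rTensor_comp]
      rfl
    _ = i.rTensor (H ⊗[k] H) ∘ₗ ((TensorProduct.assoc k M H H).toLinearMap ∘ₗ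
        M.coact.rTensor H ∘ₗ M.coact) := by
      rw [h1]
      rfl
    _ = (i.rTensor (H ⊗[k] H) ∘ₗ (Coalgebra.comul (R := k) (A := H)).lTensor M) ∘ₗ M.coact := by
      rw [M.coassoc]
      rfl
    _ = (Coalgebra.comul (R := k) (A := H)).lTensor P ∘ₗ (i.rTensor H ∘ₗ M.coact) := by
      rw [LinearMap.rTensor_comp_lTensor, ← LinearMap.lTensor_comp_rTensor]
      rfl
    _ = _ := by
      rw [← h]
      rfl

theorem counit_of_comp {P : Type u} [AddCommGroup P] [Module k P] (ρ : P →ₗ[k] P ⊗[k] H)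
    (i : M →ₗ[k] P) (h : ρ ∘ₗ i = i.rTensor H ∘ₗ M.coact) :
    ((Coalgebra.counit (R := k) (A := H)).lTensor P ∘ₗ ρ) ∘ₗ i =
      (TensorProduct.mk k P k).flip 1 ∘ₗ i := by
  calc _ = (Coalgebra.counit (R := k) (A := H)).lTensor P ∘ₗ (ρ ∘ₗ i) := rfl
    _ = i.rTensor k ∘ₗ ((Coalgebra.counit (R := k) (A := H)).lTensor M ∘ₗ M.coact) := by
      rw [h, ← LinearMap.comp_assoc, ← LinearMap.comp_assoc, LinearMap.rTensor_comp_lTensor,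
        ← LinearMap.lTensor_comp_rTensor]
    _ = _ := by
      rw [M.counit_coact]
      ext
      simp

/-- The direct sum of two comodules. -/
def prod : ComodCat k H where
  carrier := M × N
  coact := prodCoact M N
  coassoc := LinearMap.prod_ext
    (coassoc_of_comp M (prodCoact M N) _ (prodCoact_comp_inl M N))
    (coassoc_of_comp N (prodCoact M N) _ (prodCoact_comp_inr M N))
  counit_coact := LinearMap.prod_ext
    (counit_of_comp M (prodCoact M N) _ (prodCoact_comp_inl M N))
    (counit_of_comp N (prodCoact M N) _ (prodCoact_comp_inr M N))

/-- The first inclusion into the direct sum. -/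
def inl : M ⟶ prod M N := ofLin (N := prod M N) (LinearMap.inl k M N) (prodCoact_comp_inl M N)

/-- The second inclusion into the direct sum. -/
def inr : N ⟶ prod M N := ofLin (N := prod M N) (LinearMap.inr k M N) (prodCoact_comp_inr M N)

theorem coact_comp_fst :
    M.coact ∘ₗ LinearMap.fst k M N = (LinearMap.fst k M N).rTensor H ∘ₗ prodCoact M N := by
  apply LinearMap.prod_ext
  · rw [LinearMap.comp_assoc, LinearMap.comp_assoc, prodCoact_comp_inl, ← LinearMap.comp_assoc,
      ← LinearMap.comp_assoc, ← LinearMap.rTensor_comp, LinearMap.comp_assoc,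
      LinearMap.fst_comp_inl]
    simp
  · rw [LinearMap.comp_assoc, LinearMap.comp_assoc, prodCoact_comp_inr, ← LinearMap.comp_assoc,
      ← LinearMap.comp_assoc, ← LinearMap.rTensor_comp, LinearMap.comp_assoc,
      LinearMap.fst_comp_inr]
    simp

theorem coact_comp_snd :
    N.coact ∘ₗ LinearMap.snd k M N = (LinearMap.snd k M N).rTensor H ∘ₗ prodCoact M N := by
  apply LinearMap.prod_ext
  · rw [LinearMap.comp_assoc, LinearMap.comp_assoc, prodCoact_comp_inl, ← LinearMap.comp_assoc,
      ← LinearMap.comp_assoc, ← LinearMap.rTensor_comp, LinearMap.comp_assoc,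
      LinearMap.snd_comp_inl]
    simp
  · rw [LinearMap.comp_assoc, LinearMap.comp_assoc, prodCoact_comp_inr, ← LinearMap.comp_assoc,
      ← LinearMap.comp_assoc, ← LinearMap.rTensor_comp, LinearMap.comp_assoc,
      LinearMap.snd_comp_inr]
    simp

/-- The first projection from the direct sum. -/
def fst : prod M N ⟶ M := ofLin (M := prod M N) (LinearMap.fst k M N) (coact_comp_fst M N)

/-- The second projection from the direct sum. -/
def snd : prod M N ⟶ N := ofLin (M := prod M N) (LinearMap.snd k M N) (coact_comp_snd M N)

theorem injective_prod [Injective M] [Injective N] : Injective (prod M N) where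
  factors {X Y} g f hf := by
    refine ⟨Injective.factorThru (g ≫ fst M N) f ≫ inl M N +
      Injective.factorThru (g ≫ snd M N) f ≫ inr M N, ?_⟩
    rw [Preadditive.comp_add, ← Category.assoc, ← Category.assoc, Injective.comp_factorThru,
      Injective.comp_factorThru]
    apply lin_injective
    ext x
    change ((lin g x).1 + 0, 0 + (lin g x).2) = lin g x
    rw [add_zero, zero_add]
    rfl

end Prod

/-- A morphism factors through an injective object of the category of comodules. -/
def FactorsThroughInjective {M N : ComodCat k H} (f : M ⟶ N) : Prop :=
  ∃ (I : ComodCat k H) (_ : Injective I) (a : M ⟶ I) (b : I ⟶ N), a ≫ b = f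

theorem injective_trivial_of_subsingleton (M : ComodCat k H) [Subsingleton M] : Injective M where
  factors _ _ _ := ⟨0, lin_injective _ _ (LinearMap.ext fun _ => Subsingleton.elim _ _)⟩

variable (k H) in
/-- The zero comodule. -/
def zero : ComodCat k H where
  carrier := PUnit
  coact := 0
  coassoc := Subsingleton.elim _ _
  counit_coact := Subsingleton.elim _ _

instance : Subsingleton (zero k H) := inferInstanceAs (Subsingleton PUnit)

/-- The space of morphisms that factor through an injective comodule. -/
def injHom (M N : ComodCat k H) : Submodule k (M ⟶ N) where
  carrier := {f | FactorsThroughInjective f}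
  zero_mem' := ⟨zero k H, injective_trivial_of_subsingleton _, 0, 0, by simp⟩
  add_mem' := by
    rintro _ _ ⟨I, hI, a, b, rfl⟩ ⟨J, hJ, c, d, rfl⟩
    refine ⟨prod I J, injective_prod I J, a ≫ inl I J + c ≫ inr I J,
      fst I J ≫ b + snd I J ≫ d, ?_⟩
    apply lin_injective
    ext x
    change lin b (lin a x + 0) + lin d (0 + lin c x) = lin b (lin a x) + lin d (lin c x)
    rw [add_zero, zero_add]
  smul_mem' := by
    rintro t _ ⟨I, hI, a, b, rfl⟩
    exact ⟨I, hI, a, t • b, by rw [Linear.comp_smul]⟩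

theorem comp_mem_injHom_left {M N P : ComodCat k H} {f : M ⟶ N} (hf : f ∈ injHom M N)
    (g : N ⟶ P) : f ≫ g ∈ injHom M P := by
  obtain ⟨I, hI, a, b, rfl⟩ := hf
  exact ⟨I, hI, a, b ≫ g, by rw [Category.assoc]⟩

theorem comp_mem_injHom_right {M N P : ComodCat k H} (f : M ⟶ N) {g : N ⟶ P}
    (hg : g ∈ injHom N P) : f ≫ g ∈ injHom M P := by
  obtain ⟨I, hI, a, b, rfl⟩ := hg
  exact ⟨I, hI, f ≫ a, b, by rw [Category.assoc]⟩

/-- The Hom space in the stable category: morphisms of comodules modulo those that factor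
through an injective comodule. -/
abbrev StableHom (M N : ComodCat k H) : Type u := (M ⟶ N) ⧸ injHom M N

/-- Composition of stable morphisms, as a bilinear map. -/
def stableComp (M N P : ComodCat k H) :
    StableHom M N →ₗ[k] StableHom N P →ₗ[k] StableHom M P :=
  Submodule.liftQ (injHom M N)
    { toFun := fun f => Submodule.mapQ (injHom N P) (injHom M P) (Linear.leftComp k P f)
        (fun _ hg => comp_mem_injHom_right f hg)
      map_add' := fun f f' => by
        refine Submodule.linearMap_qext _ (LinearMap.ext fun g => ?_)
        exact congrArg (Submodule.Quotient.mk (p := injHom M P)) (Preadditive.add_comp _ _ _ f f' g)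
      map_smul' := fun c f => by
        refine Submodule.linearMap_qext _ (LinearMap.ext fun g => ?_)
        exact congrArg (Submodule.Quotient.mk (p := injHom M P)) (Linear.smul_comp _ _ _ c f g) }
    (fun f hf => by
      refine Submodule.linearMap_qext _ (LinearMap.ext fun g => ?_)
      exact (Submodule.Quotient.mk_eq_zero (injHom M P)).2 (comp_mem_injHom_left hf g))

theorem stableComp_mk {M N P : ComodCat k H} (f : M ⟶ N) (g : N ⟶ P) :
    stableComp M N P (Submodule.Quotient.mk f) (Submodule.Quotient.mk g) =
      Submodule.Quotient.mk (f ≫ g) := rfl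

end ComodCat

/-- The stable category of `H`-comodules: its objects are the `H`-comodules. -/
structure StableComodCat (k H : Type u) [Field k] [Ring H] [HopfAlgebra k H] where
  obj : ComodCat k H

namespace StableComodCat

variable {k H : Type u} [Field k] [Ring H] [HopfAlgebra k H]

open ComodCat

instance : Category (StableComodCat k H) where
  Hom M N := StableHom M.obj N.obj
  id M := Submodule.Quotient.mk (𝟙 M.obj)
  comp f g := stableComp _ _ _ f g
  id_comp f := by
    obtain ⟨f, rfl⟩ := Submodule.Quotient.mk_surjective _ f
    rw [stableComp_mk, Category.id_comp]
  comp_id f := by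
    obtain ⟨f, rfl⟩ := Submodule.Quotient.mk_surjective _ f
    rw [stableComp_mk, Category.comp_id]
  assoc f g h := by
    obtain ⟨f, rfl⟩ := Submodule.Quotient.mk_surjective _ f
    obtain ⟨g, rfl⟩ := Submodule.Quotient.mk_surjective _ g
    obtain ⟨h, rfl⟩ := Submodule.Quotient.mk_surjective _ h
    simp only [stableComp_mk, Category.assoc]

instance (M N : StableComodCat k H) : AddCommGroup (M ⟶ N) :=
  inferInstanceAs (AddCommGroup (StableHom M.obj N.obj))

instance (M N : StableComodCat k H) : Module k (M ⟶ N) :=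
  inferInstanceAs (Module k (StableHom M.obj N.obj))

/-- The stable class of a morphism of comodules. -/
def cls {M N : ComodCat k H} (f : M ⟶ N) : (⟨M⟩ : StableComodCat k H) ⟶ ⟨N⟩ :=
  Submodule.Quotient.mk (p := injHom M N) f

theorem cls_surjective {M N : StableComodCat k H} (f : M ⟶ N) :
    ∃ g : M.obj ⟶ N.obj, cls g = f := Submodule.Quotient.mk_surjective _ f

theorem cls_comp {M N P : ComodCat k H} (f : M ⟶ N) (g : N ⟶ P) :
    cls (f ≫ g) = cls f ≫ cls g := rfl

theorem cls_add {M N : ComodCat k H} (f g : M ⟶ N) : cls (f + g) = cls f + cls g := rfl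

theorem cls_smul {M N : ComodCat k H} (c : k) (f : M ⟶ N) : cls (c • f) = c • cls f := rfl

instance : Preadditive (StableComodCat k H) where
  add_comp M N P f f' g := by
    obtain ⟨f, rfl⟩ := cls_surjective f
    obtain ⟨f', rfl⟩ := cls_surjective f'
    obtain ⟨g, rfl⟩ := cls_surjective g
    exact congrArg cls (Preadditive.add_comp _ _ _ f f' g)
  comp_add M N P f g g' := by
    obtain ⟨f, rfl⟩ := cls_surjective f
    obtain ⟨g, rfl⟩ := cls_surjective g
    obtain ⟨g', rfl⟩ := cls_surjective g'
    exact congrArg cls (Preadditive.comp_add _ _ _ f g g')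

instance : Linear k (StableComodCat k H) where
  smul_comp M N P c f g := by
    obtain ⟨f, rfl⟩ := cls_surjective f
    obtain ⟨g, rfl⟩ := cls_surjective g
    exact congrArg cls (Linear.smul_comp _ _ _ c f g)
  comp_smul M N P f c g := by
    obtain ⟨f, rfl⟩ := cls_surjective f
    obtain ⟨g, rfl⟩ := cls_surjective g
    exact congrArg cls (Linear.comp_smul _ _ _ f c g)

end StableComodCat

namespace ComodCat

variable {k H : Type u} [Field k] [Ring H] [HopfAlgebra k H]

/-- The coinvariants of `M`: all `m` with `ρ(m) = m ⊗ 1`. -/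
def coinvariants (M : ComodCat k H) : Submodule k M :=
  LinearMap.eqLocus M.coact ((TensorProduct.mk k M H).flip 1)

theorem mem_coinvariants {M : ComodCat k H} {m : M} :
    m ∈ coinvariants M ↔ M.coact m = m ⊗ₜ[k] (1 : H) := Iff.rfl

/-- The action of a linear form `Λ` on `H` on a right comodule: `Λ · m = Λ(m₁) m₀`. -/
def act (Λ : H →ₗ[k] k) (M : ComodCat k H) : M →ₗ[k] M :=
  (TensorProduct.rid k M).toLinearMap ∘ₗ Λ.lTensor M ∘ₗ M.coact

theorem lin_act (Λ : H →ₗ[k] k) {M N : ComodCat k H} (f : M ⟶ N) (m : M) :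
    lin f (act Λ M m) = act Λ N (lin f m) := by
  have h : lin f ∘ₗ (TensorProduct.rid k M).toLinearMap ∘ₗ Λ.lTensor M =
      ((TensorProduct.rid k N).toLinearMap ∘ₗ Λ.lTensor N) ∘ₗ (lin f).rTensor H := by
    ext
    simp
  change (lin f ∘ₗ (TensorProduct.rid k M).toLinearMap ∘ₗ Λ.lTensor M) (M.coact m) =
    ((TensorProduct.rid k N).toLinearMap ∘ₗ Λ.lTensor N) (N.coact (lin f m))
  rw [h, coact_lin]
  rfl

theorem lin_mem_coinvariants {M N : ComodCat k H} (f : M ⟶ N) {m : M}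
    (hm : m ∈ coinvariants M) : lin f m ∈ coinvariants N := by
  rw [mem_coinvariants] at hm ⊢
  rw [coact_lin, hm, LinearMap.rTensor_tmul]

/-- For a left integral `Λ`, the image `Λ · M` consists of coinvariants. -/
theorem act_mem_coinvariants {Λ : H →ₗ[k] k} (hΛ : IsLeftIntegral Λ) (M : ComodCat k H) (m : M) :
    act Λ M m ∈ coinvariants M := by
  have h1 : M.coact ∘ₗ (TensorProduct.rid k M).toLinearMap ∘ₗ Λ.lTensor M =
      (TensorProduct.rid k (M ⊗[k] H)).toLinearMap ∘ₗ Λ.lTensor (M ⊗[k] H) ∘ₗ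
        M.coact.rTensor H := by
    ext
    simp
  have h2 : (TensorProduct.rid k (M ⊗[k] H)).toLinearMap ∘ₗ Λ.lTensor (M ⊗[k] H) =
      ((TensorProduct.rid k H).toLinearMap ∘ₗ Λ.lTensor H).lTensor M ∘ₗ
        (TensorProduct.assoc k M H H).toLinearMap := by
    ext
    simp
  have h3 : ((TensorProduct.rid k H).toLinearMap ∘ₗ Λ.lTensor H) ∘ₗ
      (Coalgebra.comul (R := k) (A := H)) = LinearMap.toSpanSingleton k H 1 ∘ₗ Λ := by
    ext h
    exact hΛ h
  have h4 : (LinearMap.toSpanSingleton k H 1).lTensor M ∘ₗ Λ.lTensor M =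
      (TensorProduct.mk k M H).flip 1 ∘ₗ (TensorProduct.rid k M).toLinearMap ∘ₗ Λ.lTensor M := by
    ext
    simp
  have h5 : M.coact ∘ₗ act Λ M = (TensorProduct.mk k M H).flip 1 ∘ₗ act Λ M := by
    calc _ = (M.coact ∘ₗ (TensorProduct.rid k M).toLinearMap ∘ₗ Λ.lTensor M) ∘ₗ M.coact := rfl
      _ = ((TensorProduct.rid k (M ⊗[k] H)).toLinearMap ∘ₗ Λ.lTensor (M ⊗[k] H)) ∘ₗ
          M.coact.rTensor H ∘ₗ M.coact := by
        rw [h1]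
        rfl
      _ = ((TensorProduct.rid k H).toLinearMap ∘ₗ Λ.lTensor H).lTensor M ∘ₗ
          ((TensorProduct.assoc k M H H).toLinearMap ∘ₗ M.coact.rTensor H ∘ₗ M.coact) := by
        rw [h2]
        rfl
      _ = (((TensorProduct.rid k H).toLinearMap ∘ₗ Λ.lTensor H) ∘ₗ
          (Coalgebra.comul (R := k) (A := H))).lTensor M ∘ₗ M.coact := by
        rw [M.coassoc, LinearMap.lTensor_comp M (_ ∘ₗ _) (Coalgebra.comul (R := k) (A := H)),
          LinearMap.comp_assoc]
      _ = ((LinearMap.toSpanSingleton k H 1).lTensor M ∘ₗ Λ.lTensor M) ∘ₗ M.coact := by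
        rw [h3, LinearMap.lTensor_comp]
      _ = _ := by
        rw [h4]
        rfl
  exact LinearMap.congr_fun h5 m

/-- The image `Λ · M`, as a subspace of the coinvariants. -/
def integralImage (Λ : H →ₗ[k] k) (M : ComodCat k H) : Submodule k (coinvariants M) :=
  (LinearMap.range (act Λ M)).comap (coinvariants M).subtype

/-- The map induced on coinvariants by a morphism of comodules. -/
def coinvariantsMap {M N : ComodCat k H} (f : M ⟶ N) : coinvariants M →ₗ[k] coinvariants N :=
  (lin f).restrict (fun _ hm => lin_mem_coinvariants f hm)

/-- The Hopfological homology `H₀(M) = M^{co H} / Λ · M`, as a functor on comodules. -/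
def homologyZero (Λ : H →ₗ[k] k) : ComodCat k H ⥤ ModuleCat.{u} k where
  obj M := ModuleCat.of k (coinvariants M ⧸ integralImage Λ M)
  map {M N} f := ModuleCat.ofHom (Submodule.mapQ (integralImage Λ M) (integralImage Λ N)
    (coinvariantsMap f) (by
      rintro m ⟨x, hx⟩
      exact ⟨lin f x, by rw [← lin_act, hx]; rfl⟩))
  map_id M := by
    apply ModuleCat.hom_ext
    exact Submodule.linearMap_qext _ rfl
  map_comp f g := by
    apply ModuleCat.hom_ext
    exact Submodule.linearMap_qext _ rfl

/-- The class in `H₀(M)` of a coinvariant element. -/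
def homologyClass (Λ : H →ₗ[k] k) {M : ComodCat k H} (m : coinvariants M) :
    (homologyZero Λ).obj M :=
  Submodule.Quotient.mk (p := integralImage Λ M) m

/-- The coinvariant element `f(1)` attached to a morphism `f : k ⟶ M`. -/
def evalOne {M : ComodCat k H} (f : trivial k H ⟶ M) : coinvariants M :=
  ⟨lin f (1 : k), lin_mem_coinvariants f (m := (1 : k)) rfl⟩

instance (Λ : H →ₗ[k] k) : (homologyZero Λ).Additive where
  map_add := ModuleCat.hom_ext (Submodule.linearMap_qext _ rfl)

instance (Λ : H →ₗ[k] k) : (homologyZero Λ).Linear k where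
  map_smul _ _ := ModuleCat.hom_ext (Submodule.linearMap_qext _ rfl)

/-- The functor induced by `H₀` on the stable category, given that `H₀` kills the morphisms
that factor through an injective comodule. -/
def stableHomologyZero (Λ : H →ₗ[k] k)
    (hinj : ∀ (M N : ComodCat k H) (f : M ⟶ N), FactorsThroughInjective f →
      (homologyZero Λ).map f = 0) :
    StableComodCat k H ⥤ ModuleCat.{u} k where
  obj M := (homologyZero Λ).obj M.obj
  map {M N} f := Submodule.liftQ (injHom M.obj N.obj)
    ((homologyZero Λ).mapLinearMap k (X := M.obj) (Y := N.obj))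
    (fun g hg => hinj M.obj N.obj g hg) f
  map_id M := (homologyZero Λ).map_id M.obj
  map_comp f g := by
    obtain ⟨f, rfl⟩ := Submodule.Quotient.mk_surjective _ f
    obtain ⟨g, rfl⟩ := Submodule.Quotient.mk_surjective _ g
    exact (homologyZero Λ).map_comp f g

end ComodCat

/-! A colinear map `k → M` is the same as the coinvariant element `f(1)`, so everything reduces to
one equivalence (`mem_injHom_iff`): `f` factors through an injective comodule exactly when `f(1) ∈ Λ
· M`.

If `f` factors through an injective `I`, it suffices that every coinvariant of `I` lies in `Λ · I`,
since colinear maps commute with `Λ ·`. The coaction `I → I ⊗ H` into the cofree comodule is mono,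
hence split by some colinear `p`. It sends a coinvariant `m` to `m ⊗ 1 = Λ · (m ⊗ h)` for any `h`
with `Λ(h) = 1`, so `m = Λ · p(m ⊗ h)`. This is where `Λ ≠ 0` enters (`mem_range_act_of_injective`),
and the same fact shows that `H₀` kills maps through injectives.

Conversely, `m ⊗ h ↦ Λ(m₁ S(h)) m₀` is a map `M ⊗ H → M` that sends the coinvariant `m ⊗ 1` to `Λ ·
m`. It is colinear (`twistedActHom`) because `x₁ Λ(x₂ S(h)) = Λ(x S(h₁)) h₂` for a left integral. As
`M ⊗ H` is injective (`injective_cofree`), the map `k → M` with value `Λ · m` at `1` factors through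
an injective. -/

/-! ### Antipode and left integrals. -/

section Antipode

variable {k H : Type u} [Field k] [Ring H] [HopfAlgebra k H]

open WithConv LinearMap in
/-- In a Hopf algebra, `Δ(S(h₁)) (h₂ ⊗ 1) = 1 ⊗ S(h)`. -/
theorem HopfAlgebra.sum_comul_antipode_mul_tmul_one {ι : Type*} {h : H}
    (r : Coalgebra.Repr k h ι) :
    ∑ i ∈ r.index, Coalgebra.comul (R := k) (HopfAlgebra.antipode k (r.left i)) *
      (r.right i ⊗ₜ[k] (1 : H)) = 1 ⊗ₜ[k] HopfAlgebra.antipode k h := by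
  let il : H →ₐ[k] H ⊗[k] H := Algebra.TensorProduct.includeLeft
  let ir : H →ₐ[k] H ⊗[k] H := Algebra.TensorProduct.includeRight
  let δ : H →ₐ[k] H ⊗[k] H := Bialgebra.comulAlgHom k H
  -- Algebra maps preserve the convolution unit, so the two antipode identities can be pushed
  -- forward along `δ` and `ir`.
  have hone : ∀ φ : H →ₐ[k] H ⊗[k] H,
      toConv (φ.toLinearMap ∘ₗ (1 : WithConv (H →ₗ[k] H)).ofConv) = 1 := fun φ => by
    ext x
    simp [LinearMap.convOne_def, AlgHom.commutes]
  have hleft : toConv (δ.toLinearMap ∘ₗ antipode k (A := H)) * toConv δ.toLinearMap = 1 := by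
    have := algHom_comp_convMul_distrib δ (toConv (antipode k (A := H))) (toConv LinearMap.id)
    rw [antipode_mul_id] at this
    rw [← hone δ, this]
    rfl
  have hright : toConv ir.toLinearMap * toConv (ir.toLinearMap ∘ₗ antipode k (A := H)) = 1 := by
    have := algHom_comp_convMul_distrib ir (toConv LinearMap.id) (toConv (antipode k (A := H)))
    rw [id_mul_antipode] at this
    rw [← hone ir, this]
    rfl
  have hmul : toConv il.toLinearMap * toConv ir.toLinearMap = toConv δ.toLinearMap := by
    ext x
    rw [(Coalgebra.Repr.arbitrary k x).convMul_apply]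
    simp [il, ir, δ, Coalgebra.Repr.eq]
  -- Under convolution `δ = il * ir`, with `δ ∘ S` a left inverse of `δ` and `ir ∘ S` a right
  -- inverse of `ir`. Hence `(δ ∘ S) * il = (δ ∘ S) * il * ir * (ir ∘ S) = ir ∘ S`. No formula for
  -- `Δ ∘ S` is needed.
  have key : toConv (δ.toLinearMap ∘ₗ antipode k (A := H)) * toConv il.toLinearMap =
      toConv (ir.toLinearMap ∘ₗ antipode k (A := H)) := by
    rw [← mul_one (_ * toConv il.toLinearMap), ← hright, mul_assoc,
      ← mul_assoc (toConv il.toLinearMap), hmul, ← mul_assoc, hleft, one_mul]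
  have := congrArg (fun f : WithConv (H →ₗ[k] H ⊗[k] H) => f h) key
  simp only [r.convMul_apply] at this
  exact this

/-- For a left integral `Λ`, one has `x₁ Λ(x₂ S(h)) = Λ(x S(h₁)) h₂`. -/
theorem IsLeftIntegral.rid_lTensor_comul_mul_antipode {Λ : H →ₗ[k] k} (hΛ : IsLeftIntegral Λ)
    (x : H) {ι : Type*} {h : H} (r : Coalgebra.Repr k h ι) :
    TensorProduct.rid k H ((Λ ∘ₗ LinearMap.mulRight k (HopfAlgebra.antipode k h)).lTensor H
      (Coalgebra.comul (R := k) x)) =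
      ∑ i ∈ r.index, Λ (x * HopfAlgebra.antipode k (r.left i)) • r.right i := by
  let T : H ⊗[k] H →ₗ[k] H := (TensorProduct.rid k H).toLinearMap ∘ₗ Λ.lTensor H
  -- `T` integrates only the second leg, so right multiplication on the first leg passes through it.
  have hT : ∀ (z : H ⊗[k] H) (y : H), T (z * (y ⊗ₜ[k] (1 : H))) = T z * y := fun z y => by
    induction z with
    | zero => simp
    | tmul a b => simp [T]
    | add a b ha hb => rw [add_mul, map_add, map_add, ha, hb, add_mul]
  have hT' : ∀ z : H ⊗[k] H, TensorProduct.rid k H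
      ((Λ ∘ₗ LinearMap.mulRight k (HopfAlgebra.antipode k h)).lTensor H z) =
        T (z * (1 ⊗ₜ[k] HopfAlgebra.antipode k h)) := fun z => by
    induction z with
    | zero => simp
    | tmul a b => simp [T]
    | add a b ha hb => rw [map_add, map_add, ha, hb, add_mul, map_add]
  -- Replacing `1 ⊗ S(h)` by `Δ(S(h₁)) (h₂ ⊗ 1)` turns the argument of `T` into `Δ(x S(h₁)) (h₂ ⊗
  -- 1)`, to which the integral property applies.
  rw [hT', ← HopfAlgebra.sum_comul_antipode_mul_tmul_one r, Finset.mul_sum, map_sum]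
  refine Finset.sum_congr rfl fun i _ => ?_
  rw [← mul_assoc, ← Bialgebra.comul_mul, hT]
  change (TensorProduct.rid k H (Λ.lTensor H _)) * _ = _
  rw [hΛ, smul_mul_assoc, one_mul]

end Antipode

namespace ComodCat

variable {k H : Type u} [Field k] [Ring H] [HopfAlgebra k H]

/-! ### Kernels of comodule maps; monomorphisms are the injective colinear maps. -/

section Kernel

variable {M N : ComodCat k H} (f : M ⟶ N)

/-- By flatness of `H`, the image of `ker f ⊗ H` in `M ⊗ H` is the kernel of `f ⊗ H`, and
colinearity puts the coaction of a kernel element there. -/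
theorem coact_mem_range_rTensor_ker (x : LinearMap.ker (lin f)) :
    M.coact x ∈ LinearMap.range ((LinearMap.ker (lin f)).subtype.rTensor H) := by
  have hex := Module.Flat.rTensor_exact H (LinearMap.exact_subtype_ker_map (lin f))
  refine (hex _).1 ?_
  rw [← coact_lin, x.2, map_zero]

theorem rTensor_subtype_ker_injective :
    Function.Injective ((LinearMap.ker (lin f)).subtype.rTensor H) :=
  Module.Flat.rTensor_preserves_injective_linearMap _ (Submodule.injective_subtype _)

/-- The coaction on the kernel of a morphism. -/
noncomputable def kerCoact : LinearMap.ker (lin f) →ₗ[k] LinearMap.ker (lin f) ⊗[k] H :=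
  (LinearEquiv.ofInjective _ (rTensor_subtype_ker_injective f)).symm.toLinearMap ∘ₗ
    (M.coact ∘ₗ (LinearMap.ker (lin f)).subtype).codRestrict _ (coact_mem_range_rTensor_ker f)

theorem coact_comp_subtype_ker :
    M.coact ∘ₗ (LinearMap.ker (lin f)).subtype =
      (LinearMap.ker (lin f)).subtype.rTensor H ∘ₗ kerCoact f := by
  ext x
  exact (congrArg Subtype.val (LinearEquiv.apply_symm_apply
    (LinearEquiv.ofInjective _ (rTensor_subtype_ker_injective f))
      ⟨M.coact x, coact_mem_range_rTensor_ker f x⟩)).symm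

/-- The kernel of a morphism of comodules. -/
noncomputable def ker : ComodCat k H where
  carrier := LinearMap.ker (lin f)
  coact := kerCoact f
  coassoc := by
    -- By flatness the identity may be checked after embedding into `M ⊗ (H ⊗ H)`, where it is the
    -- coassociativity of `M`.
    have hi := Module.Flat.rTensor_preserves_injective_linearMap (M := H ⊗[k] H)
      (LinearMap.ker (lin f)).subtype (Submodule.injective_subtype _)
    generalize hj : (LinearMap.ker (lin f)).subtype = i at hi
    have h0 : M.coact ∘ₗ i = i.rTensor H ∘ₗ kerCoact f := hj ▸ coact_comp_subtype_ker f
    have h1 : i.rTensor (H ⊗[k] H) ∘ₗ (TensorProduct.assoc k _ H H).toLinearMap =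
        (TensorProduct.assoc k M H H).toLinearMap ∘ₗ (i.rTensor H).rTensor H := by
      ext
      simp
    have h2 : (TensorProduct.assoc k M H H).toLinearMap ∘ₗ M.coact.rTensor H ∘ₗ
        M.coact ∘ₗ i = (Coalgebra.comul (R := k) (A := H)).lTensor M ∘ₗ M.coact ∘ₗ i := by
      exact congrArg (· ∘ₗ i) M.coassoc
    refine LinearMap.ext fun x => hi ?_
    change (i.rTensor (H ⊗[k] H) ∘ₗ (TensorProduct.assoc k _ H H).toLinearMap)
        ((kerCoact f).rTensor H (kerCoact f x)) =
      (i.rTensor (H ⊗[k] H) ∘ₗ (Coalgebra.comul (R := k) (A := H)).lTensor _) (kerCoact f x)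
    rw [h1, LinearMap.rTensor_comp_lTensor, ← LinearMap.lTensor_comp_rTensor]
    have h3 : (i.rTensor H).rTensor H ∘ₗ (kerCoact f).rTensor H =
        M.coact.rTensor H ∘ₗ i.rTensor H := by
      rw [← LinearMap.rTensor_comp, ← h0, LinearMap.rTensor_comp]
    have h4 := LinearMap.congr_fun h3 (kerCoact f x)
    have h5 := LinearMap.congr_fun h0 x
    have h6 := LinearMap.congr_fun h2 x
    simp only [LinearMap.comp_apply] at h4 h5 h6 ⊢
    rw [h4, ← h5]
    exact h6
  counit_coact := by
    have hi := Module.Flat.rTensor_preserves_injective_linearMap (M := k)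
      (LinearMap.ker (lin f)).subtype (Submodule.injective_subtype _)
    refine LinearMap.ext fun x => hi ?_
    have h0 := LinearMap.congr_fun (coact_comp_subtype_ker f) x
    have h1 := LinearMap.congr_fun M.counit_coact (x : M)
    have h2 := LinearMap.congr_fun (LinearMap.rTensor_comp_lTensor
      (f := (LinearMap.ker (lin f)).subtype) (g := Coalgebra.counit (R := k) (A := H))) (kerCoact f x)
    have h3 := LinearMap.congr_fun (LinearMap.lTensor_comp_rTensor
      (f := (LinearMap.ker (lin f)).subtype) (g := Coalgebra.counit (R := k) (A := H))) (kerCoact f x)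
    simp only [LinearMap.comp_apply] at h0 h1 h2 h3 ⊢
    rw [h2, ← h3, ← h0]
    exact h1

/-- The inclusion of the kernel of a morphism. -/
noncomputable def kerι : ker f ⟶ M :=
  ofLin (M := ker f) (LinearMap.ker (lin f)).subtype (coact_comp_subtype_ker f)

/-- Injective objects are tested against categorical monomorphisms, while linear retractions need
injective linear maps. The kernel comodule bridges the two: its inclusion and the zero map agree
after `f`, so the inclusion is zero. -/
theorem lin_injective_of_mono [Mono f] : Function.Injective (lin f) := by
  have h0 : kerι f ≫ f = 0 ≫ f := lin_injective _ _ <| by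
    change lin f ∘ₗ (LinearMap.ker (lin f)).subtype = lin f ∘ₗ 0
    ext x
    simp
  have h1 := (cancel_mono f).1 h0
  refine (injective_iff_map_eq_zero _).2 fun x hx => ?_
  exact LinearMap.congr_fun (congrArg lin h1) (⟨x, hx⟩ : LinearMap.ker (lin f))

theorem mono_of_lin_injective (hf : Function.Injective (lin f)) : Mono f where
  right_cancellation _ _ h := lin_injective _ _ <| LinearMap.ext fun x =>
    hf (LinearMap.congr_fun (congrArg lin h) x)

end Kernel

/-! ### Cofree comodules and their injectivity. -/

section Cofree

variable (k H) in
/-- The regular comodule `H`, with coaction `Δ`. -/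
def regular : ComodCat k H where
  carrier := H
  coact := Coalgebra.comul
  coassoc := Coalgebra.coassoc
  counit_coact := LinearMap.ext Coalgebra.lTensor_counit_comul

variable (V : Type u) [AddCommGroup V] [Module k V]

variable (k H) in
/-- The coaction `v ⊗ h ↦ (v ⊗ h₁) ⊗ h₂` on `V ⊗ H`. -/
def cofreeCoact : V ⊗[k] H →ₗ[k] (V ⊗[k] H) ⊗[k] H :=
  (TensorProduct.assoc k V H H).symm.toLinearMap ∘ₗ
    (Coalgebra.comul (R := k) (A := H)).lTensor V

variable {V} in
theorem cofreeCoact_tmul (v : V) {ι : Type*} {h : H} (r : Coalgebra.Repr k h ι) :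
    cofreeCoact k H V (v ⊗ₜ[k] h) =
      ∑ i ∈ r.index, (v ⊗ₜ[k] r.left i) ⊗ₜ[k] r.right i := by
  simp [cofreeCoact, ← r.eq, TensorProduct.tmul_sum]

variable {V} in
-- `V ⊗ H` is spanned by the images of the maps `h ↦ v ⊗ h` from the regular comodule, so this
-- compatibility reduces its comodule axioms to those of `H`.
theorem cofreeCoact_comp_mk (v : V) :
    cofreeCoact k H V ∘ₗ TensorProduct.mk k V H v =
      (TensorProduct.mk k V H v).rTensor H ∘ₗ (regular k H).coact := by
  ext h
  let r := Coalgebra.Repr.arbitrary k h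
  change cofreeCoact k H V (v ⊗ₜ[k] h) =
    (TensorProduct.mk k V H v).rTensor H (Coalgebra.comul (R := k) h)
  rw [cofreeCoact_tmul v r]
  conv_rhs => rw [← r.eq]
  simp

variable (k H) in
/-- The cofree comodule on a vector space `V`. -/
def cofree : ComodCat k H where
  carrier := V ⊗[k] H
  coact := cofreeCoact k H V
  coassoc := TensorProduct.ext <| LinearMap.ext fun v =>
    coassoc_of_comp (regular k H) (cofreeCoact k H V) (TensorProduct.mk k V H v)
      (cofreeCoact_comp_mk (H := H) v)
  counit_coact := TensorProduct.ext <| LinearMap.ext fun v =>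
    counit_of_comp (regular k H) (cofreeCoact k H V) (TensorProduct.mk k V H v)
      (cofreeCoact_comp_mk (H := H) v)

variable {V}

/-- The morphism to a cofree comodule that corresponds to a linear map. -/
def cofreeLift {M : ComodCat k H} (φ : M →ₗ[k] V) : M ⟶ cofree k H V :=
  ofLin (N := cofree k H V) (φ.rTensor H ∘ₗ M.coact) (by
    change cofreeCoact k H V ∘ₗ φ.rTensor H ∘ₗ M.coact =
      (φ.rTensor H ∘ₗ M.coact).rTensor H ∘ₗ M.coact
    have h1 : cofreeCoact k H V ∘ₗ φ.rTensor H = (φ.rTensor H).rTensor H ∘ₗ cofreeCoact k H M := by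
      ext m h
      let r := Coalgebra.Repr.arbitrary k h
      simp [cofreeCoact_tmul _ r]
    have h2 : cofreeCoact k H M ∘ₗ M.coact = M.coact.rTensor H ∘ₗ M.coact := by
      ext m
      exact (TensorProduct.assoc k M H H).symm_apply_eq.2 (LinearMap.congr_fun M.coassoc m).symm
    rw [← LinearMap.comp_assoc, h1, LinearMap.comp_assoc, h2, LinearMap.rTensor_comp]
    rfl)

/-- The coaction of `M`, as a morphism to the cofree comodule on `M`. -/
def unitCofree (M : ComodCat k H) : M ⟶ cofree k H M := cofreeLift LinearMap.id

theorem lin_unitCofree (M : ComodCat k H) (m : M) : lin (unitCofree M) m = M.coact m := by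
  change LinearMap.rTensor H LinearMap.id (M.coact m) = _
  simp

/-- The counit axiom recovers `m` from its coaction. -/
instance (M : ComodCat k H) : Mono (unitCofree M) :=
  mono_of_lin_injective _ fun x y h => by
    rw [lin_unitCofree, lin_unitCofree] at h
    have hx := LinearMap.congr_fun M.counit_coact x
    have hy := LinearMap.congr_fun M.counit_coact y
    simp only [LinearMap.comp_apply] at hx hy
    rw [h, hy] at hx
    simpa using congrArg (TensorProduct.rid k M) hx.symm

variable (k H V) in
/-- The linear map `v ⊗ h ↦ ε(h) v`. -/
def cofreeCounit : V ⊗[k] H →ₗ[k] V :=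
  (TensorProduct.rid k V).toLinearMap ∘ₗ (Coalgebra.counit (R := k) (A := H)).lTensor V

/-- The linear map that corresponds to a morphism to a cofree comodule. -/
def cofreeProj {M : ComodCat k H} (g : M ⟶ cofree k H V) : M →ₗ[k] V :=
  cofreeCounit k H V ∘ₗ (show M →ₗ[k] V ⊗[k] H from lin g)

/-- Applying `ε` to the middle leg of the cofree coaction gives the identity. By colinearity, `g` is
thus recovered from its composite with `v ⊗ h ↦ ε(h) v`: half of the cofree adjunction. -/
theorem cofreeLift_cofreeProj {M : ComodCat k H} (g : M ⟶ cofree k H V) :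
    cofreeLift (cofreeProj g) = g := by
  apply lin_injective
  -- `g'` is `lin g` with its codomain displayed as `V ⊗ H` instead of the carrier of a comodule.
  obtain ⟨g', hg⟩ : ∃ g' : M →ₗ[k] V ⊗[k] H, g' = lin g := ⟨lin g, rfl⟩
  have hcol : cofreeCoact k H V ∘ₗ g' = g'.rTensor H ∘ₗ M.coact := hg ▸ colinear g
  rw [← hg]
  change (cofreeCounit k H V ∘ₗ (show M →ₗ[k] V ⊗[k] H from lin g)).rTensor H ∘ₗ M.coact = g'
  rw [show (show M →ₗ[k] V ⊗[k] H from lin g) = g' from hg.symm]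
  have h : (cofreeCounit k H V).rTensor H ∘ₗ cofreeCoact k H V = LinearMap.id := by
    ext v h
    let r := Coalgebra.Repr.arbitrary k h
    simp only [TensorProduct.AlgebraTensorModule.curry_apply, TensorProduct.curry_apply,
      LinearMap.coe_restrictScalars, LinearMap.comp_apply, LinearMap.id_apply,
      cofreeCoact_tmul v r, map_sum]
    conv_rhs => rw [← Coalgebra.sum_counit_smul r, TensorProduct.tmul_sum]
    simp [cofreeCounit, TensorProduct.smul_tmul]
  rw [LinearMap.rTensor_comp, LinearMap.comp_assoc, ← hcol, ← LinearMap.comp_assoc, h,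
    LinearMap.id_comp]

/-- Colinear maps into `V ⊗ H` correspond to linear maps into `V`, and over a field these extend
along the mono `f` by composing with a linear retraction `p` of it. -/
instance injective_cofree : Injective (cofree k H V) where
  factors {X Y} g f _ := by
    obtain ⟨p, hp⟩ := (lin f).exists_leftInverse_of_injective
      (LinearMap.ker_eq_bot.2 (lin_injective_of_mono f))
    refine ⟨cofreeLift (cofreeProj g ∘ₗ p), ?_⟩
    conv_rhs => rw [← cofreeLift_cofreeProj g]
    apply lin_injective
    change ((cofreeProj g ∘ₗ p).rTensor H ∘ₗ Y.coact) ∘ₗ lin f =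
      (cofreeProj g).rTensor H ∘ₗ X.coact
    rw [LinearMap.comp_assoc, colinear f, ← LinearMap.comp_assoc, ← LinearMap.rTensor_comp,
      LinearMap.comp_assoc, hp, LinearMap.comp_id]

end Cofree

/-! ### The action of the integral on injective comodules. -/

section Integral

variable {Λ : H →ₗ[k] k}

/-- The cofree coaction involves only the `H` leg, where `h₁ Λ(h₂) = Λ(h) 1`. -/
theorem act_cofree_tmul (hΛ : IsLeftIntegral Λ) {V : Type u} [AddCommGroup V] [Module k V]
    (v : V) (h : H) :
    act Λ (cofree k H V) (v ⊗ₜ[k] h : V ⊗[k] H) = (v ⊗ₜ[k] (Λ h • 1) : V ⊗[k] H) := by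
  let r := Coalgebra.Repr.arbitrary k h
  change TensorProduct.rid k (V ⊗[k] H) (Λ.lTensor (V ⊗[k] H) (cofreeCoact k H V (v ⊗ₜ[k] h))) = _
  rw [cofreeCoact_tmul v r, ← hΛ h]
  conv_rhs => rw [← r.eq]
  simp [TensorProduct.tmul_sum]

/-- On an injective comodule, every coinvariant element lies in the image of a nonzero left
integral. -/
theorem mem_range_act_of_injective (hΛ : IsLeftIntegral Λ) (hΛ0 : Λ ≠ 0) (I : ComodCat k H)
    [Injective I] {m : I} (hm : m ∈ coinvariants I) : m ∈ LinearMap.range (act Λ I) := by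
  obtain ⟨h, hh : Λ h ≠ 0⟩ := DFunLike.ne_iff.1 hΛ0
  -- Injectivity of `I` extends the identity along its coaction, giving a colinear retraction.
  let p : cofree k H I ⟶ I := Injective.factorThru (𝟙 I) (unitCofree I)
  have hp : lin p (lin (unitCofree I) m) = m :=
    LinearMap.congr_fun (congrArg lin (Injective.comp_factorThru (𝟙 I) (unitCofree I))) m
  obtain ⟨x, hx⟩ : ∃ x : cofree k H I, act Λ (cofree k H I) x = lin (unitCofree I) m := by
    -- The scalar normalises `h` so that `Λ` takes the value `1`; acting by `Λ` then yields `m ⊗ 1`,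
    -- the coaction of the coinvariant `m`.
    refine ⟨(m ⊗ₜ[k] ((Λ h)⁻¹ • h) : I ⊗[k] H), ?_⟩
    rw [lin_unitCofree, mem_coinvariants.1 hm]
    refine (act_cofree_tmul hΛ m _).trans ?_
    rw [map_smul, smul_eq_mul, inv_mul_cancel₀ hh, one_smul]
  exact ⟨lin p x, by rw [← lin_act, hx, hp]⟩

/-! ### The colinear map from `M ⊗ H` to `M` built from the integral and the antipode. -/

variable (Λ) in
/-- The linear forms `x ↦ Λ(x S(h))`, depending linearly on `h`. -/
def integralTwist : H →ₗ[k] H →ₗ[k] k :=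
  (LinearMap.mul k H).flip.compr₂ Λ ∘ₗ HopfAlgebra.antipode k

theorem integralTwist_apply (h x : H) :
    integralTwist Λ h x = Λ (x * HopfAlgebra.antipode k h) := rfl

variable (Λ) in
/-- The linear map `m ⊗ h ↦ Λ(m₁ S(h)) m₀`. -/
def twistedAct (M : ComodCat k H) : M ⊗[k] H →ₗ[k] M :=
  TensorProduct.lift <| LinearMap.flip <| LinearMap.mk₂ k
    (fun h m => act (integralTwist Λ h) M m)
    (fun h h' m => by simp [act])
    (fun c h m => by simp [act])
    (fun _ _ _ => map_add _ _ _) (fun _ _ _ => map_smul _ _ _)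

theorem twistedAct_tmul (M : ComodCat k H) (m : M) (h : H) :
    twistedAct Λ M (m ⊗ₜ[k] h) = act (integralTwist Λ h) M m := rfl

/-- The coaction on `φ · m` is `m₀ ⊗ m₁ φ(m₂)`. -/
theorem coact_act (φ : H →ₗ[k] k) (M : ComodCat k H) (m : M) :
    M.coact (act φ M m) = ((TensorProduct.rid k H).toLinearMap ∘ₗ φ.lTensor H ∘ₗ
      Coalgebra.comul (R := k) (A := H)).lTensor M (M.coact m) := by
  have h1 : M.coact ∘ₗ (TensorProduct.rid k M).toLinearMap ∘ₗ φ.lTensor M =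
      ((TensorProduct.rid k H).toLinearMap ∘ₗ φ.lTensor H).lTensor M ∘ₗ
        (TensorProduct.assoc k M H H).toLinearMap ∘ₗ M.coact.rTensor H := by
    have h2 : (TensorProduct.rid k (M ⊗[k] H)).toLinearMap ∘ₗ φ.lTensor (M ⊗[k] H) =
        ((TensorProduct.rid k H).toLinearMap ∘ₗ φ.lTensor H).lTensor M ∘ₗ
          (TensorProduct.assoc k M H H).toLinearMap := by
      ext
      simp
    rw [← LinearMap.comp_assoc, ← LinearMap.comp_assoc, ← h2]
    ext
    simp
  have h3 := LinearMap.congr_fun h1 (M.coact m)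
  have h4 := LinearMap.congr_fun M.coassoc m
  rw [← LinearMap.comp_assoc, LinearMap.lTensor_comp]
  simp only [LinearMap.comp_apply] at h3 h4 ⊢
  rw [← h4]
  exact h3

/-- For a left integral `Λ`, the map `m ⊗ h ↦ Λ(m₁ S(h)) m₀` is colinear. -/
def twistedActHom (hΛ : IsLeftIntegral Λ) (M : ComodCat k H) : cofree k H M ⟶ M :=
  ofLin (M := cofree k H M) (twistedAct Λ M) (by
    change M.coact ∘ₗ twistedAct Λ M = (twistedAct Λ M).rTensor H ∘ₗ cofreeCoact k H M
    ext m h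
    let r := Coalgebra.Repr.arbitrary k h
    -- The identity `x₁ Λ(x₂ S(h)) = Λ(x S(h₁)) h₂`, as an equality of linear maps in `x`, so that
    -- it can be applied to the `H` leg of the coaction of `m`.
    have h1 : (TensorProduct.rid k H).toLinearMap ∘ₗ (integralTwist Λ h).lTensor H ∘ₗ
        Coalgebra.comul (R := k) (A := H) =
          ∑ i ∈ r.index, (integralTwist Λ (r.left i)).smulRight (r.right i) := by
      ext x
      refine (hΛ.rid_lTensor_comul_mul_antipode x r).trans ?_
      simp [integralTwist_apply]
    change M.coact (twistedAct Λ M (m ⊗ₜ[k] h)) =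
      (twistedAct Λ M).rTensor H (cofreeCoact k H M (m ⊗ₜ[k] h))
    rw [twistedAct_tmul, coact_act, h1, cofreeCoact_tmul m r, map_sum]
    have h2 : ∀ (φ : H →ₗ[k] k) (y : H) (z : M ⊗[k] H), (φ.smulRight y).lTensor M z =
        (TensorProduct.rid k M (φ.lTensor M z)) ⊗ₜ[k] y := fun φ y z => by
      induction z with
      | zero => simp
      | tmul a b => simp [TensorProduct.smul_tmul]
      | add a b ha hb => rw [map_add, map_add, map_add, ha, hb, TensorProduct.add_tmul]
    have h3 : (∑ i ∈ r.index, (integralTwist Λ (r.left i)).smulRight (r.right i)).lTensor M =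
        ∑ i ∈ r.index, ((integralTwist Λ (r.left i)).smulRight (r.right i)).lTensor M :=
      map_sum (LinearMap.lTensorHom M) _ _
    rw [h3, LinearMap.sum_apply]
    refine Finset.sum_congr rfl fun i _ => ?_
    rw [h2, LinearMap.rTensor_tmul, twistedAct_tmul]
    rfl)

/-- The twist disappears because `S(1) = 1`. This exhibits `Λ · m` as the image of a coinvariant of
an injective comodule. -/
theorem lin_twistedActHom_tmul_one (hΛ : IsLeftIntegral Λ) (M : ComodCat k H) (m : M) :
    lin (twistedActHom hΛ M) (m ⊗ₜ[k] (1 : H) : M ⊗[k] H) = act Λ M m := by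
  have h : integralTwist Λ 1 = Λ := LinearMap.ext fun x => by
    rw [integralTwist_apply, HopfAlgebra.antipode_one, mul_one]
  change act (integralTwist Λ 1) M m = _
  rw [h]

/-! ### Morphisms from the trivial comodule and the comparison with `H₀`. -/

variable (H) in
/-- The morphism `k ⟶ M` that sends `1` to a given coinvariant element. -/
def ofCoinvariant {M : ComodCat k H} (m : coinvariants M) : trivial k H ⟶ M :=
  ofLin (M := trivial k H) (LinearMap.toSpanSingleton k M m.1) (by
    refine LinearMap.ext_ring ?_
    change M.coact ((1 : k) • m.1) =
      (LinearMap.toSpanSingleton k M m.1).rTensor H ((1 : k) ⊗ₜ[k] (1 : H))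
    rw [one_smul, mem_coinvariants.1 m.2]
    simp)

variable (k H) in
/-- The linear map `f ↦ f(1)` from morphisms `k ⟶ M` to coinvariants. -/
def evalOneₗ (M : ComodCat k H) : (trivial k H ⟶ M) →ₗ[k] coinvariants M where
  toFun := evalOne
  map_add' _ _ := rfl
  map_smul' _ _ := rfl

theorem evalOne_injective (M : ComodCat k H) :
    Function.Injective (evalOne : (trivial k H ⟶ M) → coinvariants M) := fun _ _ h =>
  lin_injective _ _ (LinearMap.ext_ring (congrArg Subtype.val h))

theorem evalOne_ofCoinvariant {M : ComodCat k H} (m : coinvariants M) :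
    evalOne (ofCoinvariant H m) = m := Subtype.ext (one_smul k m.1)

/-- A morphism `k ⟶ M` factors through an injective comodule if and only if its value at `1` lies
in `Λ · M`. -/
theorem mem_injHom_iff (hΛ : IsLeftIntegral Λ) (hΛ0 : Λ ≠ 0) {M : ComodCat k H}
    (f : trivial k H ⟶ M) :
    f ∈ injHom (trivial k H) M ↔ evalOne f ∈ integralImage Λ M := by
  constructor
  · rintro ⟨I, hI, a, b, rfl⟩
    -- Here `a(1) = Λ · x` in `I`, so `b(a(1)) = Λ · b(x)`.
    obtain ⟨x, hx⟩ := mem_range_act_of_injective hΛ hΛ0 I (evalOne a).2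
    exact ⟨lin b x, by rw [← lin_act, hx]; rfl⟩
  · rintro ⟨m, hm⟩
    have hc : (m ⊗ₜ[k] (1 : H) : M ⊗[k] H) ∈ coinvariants (cofree k H M) := by
      change cofreeCoact k H M (m ⊗ₜ[k] 1) = (m ⊗ₜ[k] 1) ⊗ₜ[k] 1
      simp [cofreeCoact, Algebra.TensorProduct.one_def]
    -- The factorisation is `1 ↦ m ⊗ 1 ↦ Λ · m = f(1)`.
    refine ⟨cofree k H M, inferInstance, ofCoinvariant H ⟨_, hc⟩, twistedActHom hΛ M, ?_⟩
    apply evalOne_injective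
    apply Subtype.ext
    change lin (twistedActHom hΛ M) (evalOne (ofCoinvariant H ⟨_, hc⟩)).1 = _
    rw [evalOne_ofCoinvariant]
    exact (lin_twistedActHom_tmul_one hΛ M m).trans hm

/-- A coinvariant of `M` lands in the coinvariants of `I`, all of which lie in `Λ · I`, and `b`
carries `Λ · I` into `Λ · N`. -/
theorem homologyZero_map_eq_zero (hΛ : IsLeftIntegral Λ) (hΛ0 : Λ ≠ 0) {M N : ComodCat k H}
    {f : M ⟶ N} (hf : FactorsThroughInjective f) : (homologyZero Λ).map f = 0 := by
  obtain ⟨I, hI, a, b, rfl⟩ := hf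
  refine ModuleCat.hom_ext <| Submodule.linearMap_qext _ <| LinearMap.ext fun m => ?_
  refine (Submodule.Quotient.mk_eq_zero (integralImage Λ N)).2 ?_
  obtain ⟨x, hx⟩ := mem_range_act_of_injective hΛ hΛ0 I (lin_mem_coinvariants a m.2)
  exact ⟨lin b x, by rw [← lin_act, hx]; rfl⟩

/-- The isomorphism from the stable morphisms `k ⟶ M` to `H₀(M)` that sends `[f]` to `[f(1)]`. -/
noncomputable def stableHomEquiv (hΛ : IsLeftIntegral Λ) (hΛ0 : Λ ≠ 0) (M : ComodCat k H) :
    StableHom (trivial k H) M ≃ₗ[k] (coinvariants M ⧸ integralImage Λ M) :=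
  -- Before any quotient, `f ↦ f(1)` is already bijective onto the coinvariants; `mem_injHom_iff`
  -- matches the two subspaces divided out.
  Submodule.Quotient.equiv _ _
    (LinearEquiv.ofBijective (evalOneₗ k H M)
      ⟨evalOne_injective M, fun m => ⟨_, evalOne_ofCoinvariant m⟩⟩) (by
    ext m
    constructor
    · rintro ⟨f, hf, rfl⟩
      exact (mem_injHom_iff hΛ hΛ0 f).1 hf
    · intro hm
      exact ⟨ofCoinvariant H m, (mem_injHom_iff hΛ hΛ0 _).2 (by rwa [evalOne_ofCoinvariant]),
        evalOne_ofCoinvariant m⟩)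

end Integral

end ComodCat

theorem mainTheorem1 {k H : Type u} [Field k] [Ring H] [HopfAlgebra k H]
    (Λ : H →ₗ[k] k) (hΛ : IsLeftIntegral Λ) (hΛ0 : Λ ≠ 0) :
    (∀ M : ComodCat k H,
      ∃ e : ComodCat.StableHom (ComodCat.trivial k H) M ≃ₗ[k]
          (ComodCat.coinvariants M ⧸ ComodCat.integralImage Λ M),
        ∀ f : ComodCat.trivial k H ⟶ M,
          e (Submodule.Quotient.mk f) = Submodule.Quotient.mk (ComodCat.evalOne f)) ∧
    ∃ hinj : ∀ (M N : ComodCat k H) (f : M ⟶ N), ComodCat.FactorsThroughInjective f →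
        (ComodCat.homologyZero Λ).map f = 0,
      ∃ Φ : (linearCoyoneda k (StableComodCat k H)).obj (Opposite.op ⟨ComodCat.trivial k H⟩) ≅
          ComodCat.stableHomologyZero Λ hinj,
        ∀ (M : ComodCat k H) (f : ComodCat.trivial k H ⟶ M),
          (Φ.hom.app ⟨M⟩).hom (StableComodCat.cls f) =
            ComodCat.homologyClass Λ (ComodCat.evalOne f) := by
  refine ⟨fun M => ⟨ComodCat.stableHomEquiv hΛ hΛ0 M, fun _ => rfl⟩,
    fun _ _ _ hf => ComodCat.homologyZero_map_eq_zero hΛ hΛ0 hf,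
    NatIso.ofComponents
      (fun M => LinearEquiv.toModuleIso (ComodCat.stableHomEquiv hΛ hΛ0 M.obj)) ?_,
    fun _ _ => rfl⟩
  -- Naturality is checked on representatives, where both composites send `f` to the class of
  -- `g(f(1))`.
  intro M N g
  obtain ⟨g, rfl⟩ := StableComodCat.cls_surjective g
  refine ModuleCat.hom_ext (LinearMap.ext fun f => ?_)
  obtain ⟨f, rfl⟩ := StableComodCat.cls_surjective f
  rfl
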